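/- Fix $\beta>0$. For a meromorphic function $G$ on $\mathbb C$ put $\rho_G(\omega)=\frac{G(\omega)-G(-\omega)}{2i}$, and call the set of poles of $G$ its spectrum. Say that $G$ is a *thermal retarded correlator* if it is holomorphic on $\{\operatorname{Im}\omega\ge 0\}$, satisfies $\overline{G(\omega)}=G(-\bar\omega)$, has only simple poles, and satisfies the thermal product hypothesis: $E(\omega)=\sinh(\beta\omega/2)/\rho_G(\omega)$ is an entire function of order (at most) one whose zeros are simple and lie at the points $\pm\omega_n$ with $\omega_n$ in the spectrum. Given radii $0<R_0<R_1<\dots\to\infty$, say that $G$ has *power-law behaviour along $(R_N)$* if for some constant $C$ one has $|G'(\omega)/G(\omega)|\le C/R_N$ for all $N$ and all $|\omega|=R_N$. For $A,B\subset\mathbb C\setminus\{0\}$ without accumulation points, products are understood as $$\prod_{n}\Bigl(1-\frac{\omega}{a_n}\Bigr)\Bigl(1+\frac{\omega}{b_n}\Bigr)=\lim_{N\to\infty}\ \prod_{a\in A,\,|a|<R_N}\Bigl(1-\frac{\omega}{a}\Bigr)\prod_{b\in B,\,|b|<R_N}\Bigl(1+\frac{\omega}{b}\Bigr).$$ Let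 $G_0$ be a thermal retarded correlator with $G_0(0)\neq0$. Define $\mu_0$ by $G_0(\omega)=G_0(0)+\tfrac i2\mu_0\beta\omega+O(\omega^2)$, and let $\lambda_0=-\mu_0/G_0(0)$. (i) If $G_0$ has only simple zeros and has power-law behaviour along some sequence of radii, then, with products taken along that sequence, $S_0(\omega)=\prod_n(1-\omega/\omega_n^{+})(1+\omega/\omega_n^{-})$ ($\omega_n^+$ the poles and $\omega_n^-$ the zeros of $G_0$) converges for every $\omega\in\mathbb C$ and $S_0(\omega)-S_0(-\omega)=2i\lambda_0\sinh(\beta\omega/2)$. (ii) For $f\in\mathbb R$ let $G(\omega;f)=\dfrac{G_0(\omega)}{1+fG_0(\omega)}$, with spectrum $\{\omega_n^f\}$. Let $f_1,f_2\in\mathbb R$ be such that $G(\cdot\,;f_1)$ and $G(\cdot\,;f_2)$ are thermal retarded correlators, and let $(R_N)$ be a sequence of radii along which $1+(f_2-f_1)G(\omega;f_1)$ has power-law behaviour. Then $1+f_1G_0(0)\ne0$, $1+f_2G_0(0)\neq 0$, the product $$S(\omega)=\prod_n\Bigl(1-\frac{\omega}{\omega_n^{f_1}}\Bigr)\Bigl(1+\frac{\omega}{\omega_n^{f_2}}\Bigr)$$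 along $(R_N)$ converges for every $\omega\in\mathbb C$, and $$S(\omega)-S(-\omega)=2i\lambda_{12}\sinh\frac{\beta\omega}{2},\qquad \lambda_{12}=\lambda_0\,\frac{(f_2-f_1)\,G_0(0)}{(1+f_1G_0(0))(1+f_2G_0(0))}.$$ -/

import Mathlib

open Filter Topology

noncomputable section

namespace SpectralDuality

/-- The spectrum of a meromorphic function: its set of poles. -/
def poles (G : ℂ → ℂ) : Set ℂ := {w | meromorphicOrderAt G w < 0}

/-- The set of zeros of a meromorphic function. -/
def zeros (G : ℂ → ℂ) : Set ℂ := {w | 0 < meromorphicOrderAt G w}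

/-- All poles are of order one. -/
def HasSimplePoles (G : ℂ → ℂ) : Prop := ∀ w ∈ poles G, meromorphicOrderAt G w = -1

/-- All zeros are of order one. -/
def HasSimpleZeros (G : ℂ → ℂ) : Prop := ∀ w ∈ zeros G, meromorphicOrderAt G w = 1

/-- The spectral density `ρ(ω) = (G(ω) - G(-ω)) / (2i)`. -/
def spectralDensity (G : ℂ → ℂ) (ω : ℂ) : ℂ := (G ω - G (-ω)) / (2 * Complex.I)

/-- A meromorphic retarded correlator of a Hermitian operator in a stable theory: meromorphic on
the plane, holomorphic on the closed upper half-plane, `conj (G ω) = G (-conj ω)` away from the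
isolated singular points, and only simple poles.
Being meromorphic functions, correlators carry no meaningful value at their singular points. -/
structure IsRetardedCorrelator (G : ℂ → ℂ) : Prop where
  meromorphic : Meromorphic G
  analyticAt : ∀ ω : ℂ, 0 ≤ ω.im → AnalyticAt ℂ G ω
  hermitian : ∀ᶠ ω in codiscrete ℂ,
    (starRingEnd ℂ) (G ω) = G (-(starRingEnd ℂ) ω)
  simplePoles : HasSimplePoles G

/-- An entire function of order (at most) one: for every `ε > 0`,
`|E ω| ≤ exp (|ω| ^ (1 + ε))` for all `ω` of large enough modulus. -/
def IsEntireOfOrderOne (E : ℂ → ℂ) : Prop :=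
  Differentiable ℂ E ∧
    ∀ ε : ℝ, 0 < ε → ∀ᶠ ω in cocompact ℂ, ‖E ω‖ ≤ Real.exp (‖ω‖ ^ (1 + ε))

/-- The thermal product hypothesis at inverse temperature `β`: the meromorphic function
`sinh (β ω / 2) / ρ(ω)` is an entire function `E` of order one. The zeros of `E` are simple and
are the points `± ω_n` with `ω_n` in the spectrum.
(The equation `E ρ = sinh` also says that `ρ` is not identically zero.) -/
def ThermalProductHypothesis (β : ℝ) (G : ℂ → ℂ) : Prop :=
  ∃ E : ℂ → ℂ, IsEntireOfOrderOne E ∧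
    (∀ᶠ ω in codiscrete ℂ, E ω * spectralDensity G ω = Complex.sinh (β * ω / 2)) ∧
    ∀ ω : ℂ, E ω = 0 → deriv E ω ≠ 0 ∧ (ω ∈ poles G ∨ -ω ∈ poles G)

/-- A strictly increasing sequence of positive radii that tends to infinity. -/
structure IsRadialSequence (R : ℕ → ℝ) : Prop where
  pos : ∀ N, 0 < R N
  strictMono : StrictMono R
  tendsto : Tendsto R atTop atTop

/-- Power-law behaviour along the circles of radius `R N`: the logarithmic derivative of `G` is
bounded by `C / R N` on them. -/
def HasPowerLaw (R : ℕ → ℝ) (G : ℂ → ℂ) : Prop :=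
  ∃ C : ℝ, ∀ N : ℕ, ∀ ω : ℂ, ‖ω‖ = R N → ‖logDeriv G ω‖ ≤ C / R N

/-- The finite product of `1 - ω / w` over the points `w ∈ A` with `|w| < r`. -/
def partialProd (A : Set ℂ) (r : ℝ) (ω : ℂ) : ℂ :=
  ∏ᶠ w ∈ {w : ℂ | w ∈ A ∧ ‖w‖ < r}, (1 - ω / w)

/-- `S(ω) = ∏ (1 - ω / a_n) (1 + ω / b_n)`, `a_n ∈ A`, `b_n ∈ B`, the product being the limit of
the products over the discs of radius `R N`. -/
def IsSpectralFunction (R : ℕ → ℝ) (A B : Set ℂ) (S : ℂ → ℂ) : Prop :=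
  ∀ ω : ℂ, Tendsto (fun N => partialProd A (R N) ω * partialProd B (R N) (-ω)) atTop (𝓝 (S ω))

/-- The spectral duality relation between `A` and `B` with constant `lam`: the product that
defines `S` converges everywhere, and `S(ω) - S(-ω) = 2 i lam sinh (β ω / 2)`. -/
def SpectralDualityRelation (β : ℝ) (R : ℕ → ℝ) (A B : Set ℂ) (lam : ℂ) : Prop :=
  ∃ S : ℂ → ℂ, IsSpectralFunction R A B S ∧
    ∀ ω : ℂ, S ω - S (-ω) = 2 * Complex.I * lam * Complex.sinh (β * ω / 2)

/-- The coefficient `μ` in `G(ω) = G(0) + (i / 2) μ β ω + …`. -/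
def thermalCoeff (β : ℝ) (G : ℂ → ℂ) : ℂ := 2 * deriv G 0 / (Complex.I * β)

/-- The spectral parameter `λ = - μ / G(0)` of a correlator. -/
def spectralParam (β : ℝ) (G : ℂ → ℂ) : ℂ := -(thermalCoeff β G) / G 0

/-- The double-trace deformed correlator `G(ω; f) = G₀(ω) / (1 + f G₀(ω))`. -/
def deformed (G₀ : ℂ → ℂ) (f : ℝ) (ω : ℂ) : ℂ := G₀ ω / (1 + f * G₀ ω)

/-- The factor `1 + (f₂ - f₁) G(ω; f₁)` that relates the theories at two couplings: its poles are
the spectrum at `f₁` and, for `f₁ ≠ f₂`, its zeros are the spectrum at `f₂`. -/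
def relativeFactor (G₀ : ℂ → ℂ) (f₁ f₂ : ℝ) (ω : ℂ) : ℂ := 1 + (f₂ - f₁) * deformed G₀ f₁ ω

end SpectralDuality

end

noncomputable section

namespace SpectralDuality

open Metric Complex

/-! Let `E` be the entire function of the thermal product hypothesis for a correlator `G`. The
identity `E(z) (G(z) - G(-z)) = 2 i sinh (β z / 2)` makes `E` even. Since `G` has no poles in the
closed upper half-plane, the zeros of `E` are exactly the poles `a` of `G` and their disjoint mirror
images. Comparing derivatives at the origin gives `E(0) μ = 1` (`exists_thermal_entire`).

Two product formulas are combined. Order one together with evenness gives `E(z) = E(0) lim ∏ (1 -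
z/a) (1 + z/a)`, with no exponential factor (`exists_hadamard_remainder`). For a meromorphic `H`
with simple zeros `b`, simple poles `a` and power-law behaviour, `H(z) = H(0) lim ∏ (1 - z/b) / ∏ (1
- z/a)` (`exists_ratio_remainder`). In `E(z) H(-z)` the factors `1 + z/a` cancel, so `S(z) = E(z)
H(-z) / (E(0) H(0))`. If the odd part of `H` is `c` times that of `G`, evenness of `E` yields `S(z)
- S(-z) = -2 i c μ sinh (β z / 2) / H(0)` (`spectralDualityRelation_of_remainder`).

Part (i) takes `H = G₀` and `c = 1`. Part (ii) takes `H = 1 + (f₂ - f₁) G(·; f₁)` and `c = f₂ - f₁`.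
The inverse of this `H` is `1 + (f₁ - f₂) G(·; f₂)`, which identifies its zeros with the second
spectrum. Equal couplings are treated separately with `H = 1`. -/

/-! ### Removable singularities and points of circles -/

/-- Two functions that are continuous at `x` and agree near `x`, except perhaps at `x`, agree
at `x`. -/
lemma eq_of_eventuallyEq_nhdsNE {f g : ℂ → ℂ} {x : ℂ} (hf : ContinuousAt f x)
    (hg : ContinuousAt g x) (h : f =ᶠ[𝓝[≠] x] g) : f x = g x :=
  ((hf.eventuallyEq_nhds_iff_eventuallyEq_nhdsNE hg).1 h).eq_of_nhds

/-- A meromorphic function on the plane agrees, up to removable singularities, with one that is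
analytic wherever the order is nonnegative and nonzero wherever the order is zero. -/
lemma exists_removable_extension {f : ℂ → ℂ} (hf : Meromorphic f) :
    ∃ F : ℂ → ℂ, (∀ x, f =ᶠ[𝓝[≠] x] F) ∧
      (∀ x, 0 ≤ meromorphicOrderAt f x → AnalyticAt ℂ F x) ∧
      (∀ x, meromorphicOrderAt f x = 0 → F x ≠ 0) := by
  have hf' : MeromorphicOn f Set.univ := meromorphicOn_univ.2 hf
  have hnf : MeromorphicNFOn (toMeromorphicNFOn f Set.univ) Set.univ :=
    meromorphicNFOn_toMeromorphicNFOn ..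
  refine ⟨toMeromorphicNFOn f Set.univ, fun x ↦ ?_, fun x hx ↦ ?_, fun x hx ↦ ?_⟩
  · exact (hf'.toMeromorphicNFOn_eq_self_on_nhdsNE (Set.mem_univ x)).symm
  · rw [← meromorphicOrderAt_toMeromorphicNFOn hf' (Set.mem_univ x)] at hx
    exact (hnf (Set.mem_univ x)).meromorphicOrderAt_nonneg_iff_analyticAt.1 hx
  · rw [← meromorphicOrderAt_toMeromorphicNFOn hf' (Set.mem_univ x)] at hx
    exact (hnf (Set.mem_univ x)).meromorphicOrderAt_eq_zero_iff.1 hx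

/-- Every point of a circle is an accumulation point of it. -/
lemma frequently_norm_eq {R : ℝ} (hR : 0 < R) {x : ℂ} (hx : ‖x‖ = R) :
    ∃ᶠ z in 𝓝[≠] x, ‖z‖ = R := by
  have hnt : (sphere (0 : ℂ) R).Nontrivial := by
    refine ⟨x, by simpa using hx, -x, by simpa using hx, fun h ↦ ?_⟩
    have : x = 0 := by simpa using self_eq_neg.1 h
    simp [this] at hx
    exact hR.ne hx
  have hpc : IsPreconnected (sphere (0 : ℂ) R) :=
    isPreconnected_sphere (by simp) 0 R
  have := accPt_iff_frequently_nhdsNE.1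
    (hpc.preperfect_of_nontrivial hnt x (by simpa using hx))
  simpa using this

/-! ### Finite products with prescribed zeros -/

/-- The product of `1 - z / w` over a finite set. -/
def rootProd (Z : Finset ℂ) (z : ℂ) : ℂ := ∏ w ∈ Z, (1 - z / w)

lemma rootProd_zero (Z : Finset ℂ) : rootProd Z 0 = 1 := by simp [rootProd]

lemma differentiable_rootProd (Z : Finset ℂ) : Differentiable ℂ (rootProd Z) := by
  unfold rootProd
  fun_prop

lemma analyticAt_rootProd (Z : Finset ℂ) (x : ℂ) : AnalyticAt ℂ (rootProd Z) x :=
  (differentiable_rootProd Z).analyticAt x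

lemma rootProd_eq_zero_iff {Z : Finset ℂ} (hZ : 0 ∉ Z) {z : ℂ} : rootProd Z z = 0 ↔ z ∈ Z := by
  rw [rootProd, Finset.prod_eq_zero_iff]
  constructor
  · rintro ⟨w, hw, h⟩
    have hw0 : w ≠ 0 := fun h0 ↦ hZ (h0 ▸ hw)
    have : z = w := by field_simp at h; linear_combination -h
    exact this ▸ hw
  · intro hz
    have hw0 : z ≠ 0 := fun h0 ↦ hZ (h0 ▸ hz)
    exact ⟨z, hz, by rw [div_self hw0, sub_self]⟩

open Classical in
lemma meromorphicOrderAt_rootProd {Z : Finset ℂ} (hZ : 0 ∉ Z) (x : ℂ) :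
    meromorphicOrderAt (rootProd Z) x = if x ∈ Z then 1 else 0 := by
  have key : ∀ w ∈ Z, meromorphicOrderAt (fun z : ℂ ↦ 1 - z / w) x = if x = w then 1 else 0 := by
    intro w hw
    have hw0 : w ≠ 0 := fun h0 ↦ hZ (h0 ▸ hw)
    have h1 : (fun z : ℂ ↦ 1 - z / w) = (fun _ ↦ -w⁻¹) * (fun z ↦ z - w) := by
      ext z; simp; field_simp; ring
    rw [h1, meromorphicOrderAt_mul_of_ne_zero analyticAt_const (by simpa using hw0)]
    split_ifs with h
    · subst h
      exact meromorphicOrderAt_id_sub_const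
    · have ha : AnalyticAt ℂ (fun z : ℂ ↦ z - w) x := by fun_prop
      rw [ha.meromorphicOrderAt_eq, ha.analyticOrderAt_eq_zero.2 (sub_ne_zero.2 h)]
      rfl
  unfold rootProd
  rw [meromorphicOrderAt_fun_prod (fun w _ ↦ by
    exact AnalyticAt.meromorphicAt (by fun_prop)), Finset.sum_congr rfl key]
  simp

/-- On the circle of twice the radius every `‖z / w‖` is at least 2, so no factor is smaller than 1.
Dividing by the product there cannot worsen a growth bound. -/
lemma one_le_norm_rootProd {Z : Finset ℂ} {r : ℝ} (hZ0 : 0 ∉ Z) (hZ : ∀ w ∈ Z, ‖w‖ < r) {z : ℂ}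
    (hz : ‖z‖ = 2 * r) : 1 ≤ ‖rootProd Z z‖ := by
  rw [rootProd, norm_prod]
  refine (Finset.prod_const_one (s := Z)).symm.trans_le
    (Finset.prod_le_prod (fun _ _ ↦ zero_le_one) fun w hw ↦ ?_)
  have hw0 : 0 < ‖w‖ := norm_pos_iff.2 fun h0 ↦ hZ0 (h0 ▸ hw)
  have h2 : 2 ≤ ‖z / w‖ := by
    rw [norm_div, hz, le_div_iff₀ hw0]
    nlinarith [hZ w hw]
  have := norm_sub_norm_le (z / w) 1
  rw [norm_sub_rev, norm_one] at this
  linarith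

/-- Finitely many zeros of an entire function can be divided out. -/
lemma exists_eq_rootProd_mul {E : ℂ → ℂ} (hE : Differentiable ℂ E) {Z : Finset ℂ} (hZ0 : 0 ∉ Z)
    (hZ : ∀ w ∈ Z, E w = 0) :
    ∃ F : ℂ → ℂ, Differentiable ℂ F ∧ ∀ z, E z = rootProd Z z * F z := by
  classical
  induction Z using Finset.induction_on with
  | empty => exact ⟨E, hE, by simp [rootProd]⟩
  | insert w Z hw ih =>
    obtain ⟨F, hF, hEF⟩ := ih (fun h ↦ hZ0 (Finset.mem_insert_of_mem h))
      (fun v hv ↦ hZ v (Finset.mem_insert_of_mem hv))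
    have hw0 : w ≠ 0 := fun h ↦ hZ0 (by simp [h])
    have hZ0' : 0 ∉ Z := fun h ↦ hZ0 (Finset.mem_insert_of_mem h)
    have hFw : F w = 0 := by
      have h1 := hZ w (Finset.mem_insert_self ..)
      rw [hEF, mul_eq_zero] at h1
      exact h1.resolve_left fun h ↦ hw ((rootProd_eq_zero_iff hZ0').1 h)
    -- Since `1 - z / w = -(z - w) / w`, the quotient of `F` by this factor is `-w` times the slope.
    refine ⟨fun z ↦ -w * dslope F w z, ?_, fun z ↦ ?_⟩
    · have : Differentiable ℂ (dslope F w) := by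
        rw [← differentiableOn_univ] at hF ⊢
        exact (Complex.differentiableOn_dslope univ_mem).2 hF
      exact this.const_mul _
    · have h1 := sub_smul_dslope_of_zero hFw z
      rw [hEF, rootProd, rootProd, Finset.prod_insert hw, ← h1, smul_eq_mul]
      field_simp
      ring

/-! ### Holomorphic logarithms and the Hadamard product of an even function of order one -/

/-- A holomorphic function without zeros on a disc has a holomorphic logarithm. -/
lemma exists_log_on_ball {g : ℂ → ℂ} {r : ℝ} (hr : 0 < r) (hg : DifferentiableOn ℂ g (ball 0 r))
    (hg0 : ∀ z ∈ ball (0 : ℂ) r, g z ≠ 0) :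
    ∃ L : ℂ → ℂ, (∀ z ∈ ball (0 : ℂ) r, HasDerivAt L (logDeriv g z) z) ∧ L 0 = 0 ∧
      ∀ z ∈ ball (0 : ℂ) r, g z = g 0 * exp (L z) := by
  have hld : DifferentiableOn ℂ (logDeriv g) (ball 0 r) :=
    (hg.deriv isOpen_ball).div hg hg0
  obtain ⟨L₁, hL₁⟩ := hld.isExactOn_ball
  have h0 : (0 : ℂ) ∈ ball (0 : ℂ) r := mem_ball_self hr
  set L : ℂ → ℂ := fun z ↦ L₁ z - L₁ 0 with hLdef
  have hL : ∀ z ∈ ball (0 : ℂ) r, HasDerivAt L (logDeriv g z) z := fun z hz ↦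
    (hL₁ z hz).sub_const _
  refine ⟨L, hL, by simp [hLdef], fun z hz ↦ ?_⟩
  have hq : ∀ w ∈ ball (0 : ℂ) r, HasDerivAt (fun w ↦ g w * exp (-L w)) 0 w := by
    intro w hw
    have h1 := (hg.differentiableAt (isOpen_ball.mem_nhds hw)).hasDerivAt.mul (hL w hw).neg.cexp
    convert! h1 using 1
    rw [logDeriv_apply]
    field_simp [hg0 w hw]
    ring
  have hconst := isOpen_ball.is_const_of_deriv_eq_zero (convex_ball (0 : ℂ) r).isPreconnected
    (fun w hw ↦ (hq w hw).differentiableAt.differentiableWithinAt)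
    (fun w hw ↦ (hq w hw).deriv) hz h0
  simp only [hLdef, sub_self, neg_zero, exp_zero, mul_one] at hconst
  rw [← hconst, mul_assoc, ← exp_add]
  simp [hLdef]

lemma rootProd_neg {Z : Finset ℂ} (hZ : ∀ w ∈ Z, -w ∈ Z) (z : ℂ) :
    rootProd Z (-z) = rootProd Z z := by
  refine Finset.prod_nbij' (fun w ↦ -w) (fun w ↦ -w) (by simpa using hZ) (by simpa using hZ)
    (by simp) (by simp) fun w _ ↦ ?_
  rw [neg_div, div_neg]

/-- If `f = c * exp t` with `t` bounded by a null sequence, then `f` tends to `c`. -/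
lemma tendsto_of_eventually_eq_mul_exp {ι : Type*} {l : Filter ι} {f : ι → ℂ} {c : ℂ} {b : ι → ℝ}
    (h : ∀ᶠ i in l, ∃ t, f i = c * exp t ∧ ‖t‖ ≤ b i) (hb : Tendsto b l (𝓝 0)) :
    Tendsto f l (𝓝 c) := by
  -- The implication lets `t` be chosen for every index, with default 0 where no exponent exists.
  have h' : ∀ i, ∃ t, (∃ t, f i = c * exp t ∧ ‖t‖ ≤ b i) → f i = c * exp t ∧ ‖t‖ ≤ b i := by
    intro i
    by_cases hi : ∃ t, f i = c * exp t ∧ ‖t‖ ≤ b i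
    · exact ⟨hi.choose, fun _ ↦ hi.choose_spec⟩
    · exact ⟨0, fun h0 ↦ absurd h0 hi⟩
  choose t ht using h'
  have ht0 : Tendsto t l (𝓝 0) :=
    squeeze_zero_norm' (h.mono fun i hi ↦ (ht i hi).2) hb
  have h1 : Tendsto (fun i ↦ c * exp (t i)) l (𝓝 (c * exp 0)) :=
    ((continuous_exp.tendsto 0).comp ht0).const_mul c
  rw [exp_zero, mul_one] at h1
  exact h1.congr' (h.mono fun i hi ↦ (ht i hi).1.symm)

/-- Dividing an even entire function with simple zeros by the product over its zeros in a disc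
leaves a factor that is close to a constant near the origin, with an error controlled by the growth
of the function. -/
lemma exists_quotient_near_const {E : ℂ → ℂ} (hE : Differentiable ℂ E) (heven : ∀ z, E (-z) = E z)
    (hsimple : ∀ z, E z = 0 → deriv E z ≠ 0) (hE0 : E 0 ≠ 0) {r M : ℝ} (hr : 0 < r) (hM : 0 < M)
    (hb : ∀ z, ‖z‖ = 2 * r → ‖E z‖ ≤ ‖E 0‖ * Real.exp M) {Z : Finset ℂ}
    (hZ : ∀ w, w ∈ Z ↔ E w = 0 ∧ ‖w‖ < r) :
    ∃ F : ℂ → ℂ, Differentiable ℂ F ∧ (∀ z, E z = rootProd Z z * F z) ∧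
      ∀ z, ‖z‖ < r / 2 → ∃ t, F z = E 0 * exp t ∧ ‖t‖ ≤ 2 * M * (‖z‖ / (r / 2)) ^ 2 := by
  have hZ0 : (0 : ℂ) ∉ Z := fun h ↦ hE0 ((hZ 0).1 h).1
  have hZneg : ∀ w ∈ Z, -w ∈ Z := fun w hw ↦ by
    rw [hZ, heven, norm_neg]
    exact (hZ w).1 hw
  obtain ⟨F, hF, hEF⟩ := exists_eq_rootProd_mul hE hZ0 (fun w hw ↦ ((hZ w).1 hw).1)
  refine ⟨F, hF, hEF, ?_⟩
  have hF0 : F 0 = E 0 := by rw [hEF, rootProd_zero, one_mul]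
  have hFne : ∀ z ∈ ball (0 : ℂ) r, F z ≠ 0 := by
    intro z hz h
    have hEz : E z = 0 := by rw [hEF, h, mul_zero]
    have hPz : rootProd Z z = 0 :=
      (rootProd_eq_zero_iff hZ0).2 ((hZ z).2 ⟨hEz, by simpa using hz⟩)
    -- A common zero of the product and of `F` would be a multiple zero of `E`.
    refine hsimple z hEz ?_
    rw [show E = rootProd Z * F from funext hEF,
      deriv_mul (differentiable_rootProd Z z) (hF z), h, hPz]
    ring
  have hFeven : ∀ᶠ z in 𝓝 (0 : ℂ), F (-z) = F z := by
    have : ∀ᶠ z in 𝓝 (0 : ℂ), rootProd Z z ≠ 0 :=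
      (differentiable_rootProd Z).continuous.continuousAt.eventually_ne (by simp [rootProd_zero])
    filter_upwards [this] with z hz
    have h1 := heven z
    rw [hEF, hEF z, rootProd_neg hZneg] at h1
    exact mul_left_cancel₀ hz h1
  -- Evenness removes the linear term of `log F`. This is what makes the usual exponential factor of
  -- genus one unnecessary.
  have hdF0 : deriv F 0 = 0 := by
    have h1 : deriv (fun z ↦ F (-z)) 0 = deriv F 0 := Filter.EventuallyEq.deriv_eq hFeven
    rw [deriv_comp_neg, neg_zero] at h1
    exact self_eq_neg.1 h1.symm
  -- Maximum principle on the disc of radius `2 * r`, on whose boundary the product has modulus at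
  -- least 1.
  have hFb : ∀ z ∈ ball (0 : ℂ) r, ‖F z‖ ≤ ‖E 0‖ * Real.exp M := by
    intro z hz
    refine norm_le_of_forall_mem_frontier_norm_le (U := ball (0 : ℂ) (2 * r)) isBounded_ball
      hF.diffContOnCl (fun w hw ↦ ?_) (subset_closure (ball_subset_ball (by linarith) hz))
    rw [frontier_ball _ (by linarith), mem_sphere_zero_iff_norm] at hw
    have h1 := one_le_norm_rootProd hZ0 (fun v hv ↦ ((hZ v).1 hv).2) hw
    calc ‖F w‖ ≤ ‖rootProd Z w‖ * ‖F w‖ := le_mul_of_one_le_left (norm_nonneg _) h1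
      _ = ‖E w‖ := by rw [hEF w, norm_mul]
      _ ≤ _ := hb w hw
  obtain ⟨L, hL, hL0, hFL⟩ := exists_log_on_ball hr hF.differentiableOn hFne
  have hLd : DifferentiableOn ℂ L (ball 0 r) := fun z hz ↦
    (hL z hz).differentiableAt.differentiableWithinAt
  have hLre : Set.MapsTo L (ball 0 r) {z | z.re ≤ M} := by
    intro z hz
    have h1 := hFb z hz
    rw [hFL z hz, norm_mul, hF0, norm_exp] at h1
    exact Real.exp_le_exp.1 (le_of_mul_le_mul_left h1 (norm_pos_iff.2 hE0))
  have hsub : ball (0 : ℂ) (r / 2) ⊆ ball 0 r := ball_subset_ball (by linarith)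
  -- Borel–Carathéodory turns `Re L ≤ M` into `‖L z‖ ≤ 2 M ‖z‖ / (r - ‖z‖)`, which is at most `2 M`
  -- on the half disc.
  have hmaps : Set.MapsTo L (ball 0 (r / 2)) (closedBall (L 0) (2 * M)) := by
    intro z hz
    have hz' : ‖z‖ < r / 2 := by simpa using hz
    have h1 := borelCaratheodory_zero hM hLd hLre hr (hsub hz) hL0
    rw [hL0, mem_closedBall_zero_iff]
    refine h1.trans ?_
    rw [div_le_iff₀ (by linarith)]
    nlinarith
  have hlo : (fun z ↦ L z - L 0) =o[𝓝 0] fun w ↦ ‖w - 0‖ ^ 1 := by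
    have h1 := hL 0 (mem_ball_self hr)
    rw [logDeriv_apply, hdF0, zero_div, hasDerivAt_iff_isLittleO] at h1
    simpa using h1.norm_right
  intro z hz
  have hz' : z ∈ ball (0 : ℂ) (r / 2) := by simpa using hz
  refine ⟨L z, by rw [hFL z (hsub hz'), hF0], ?_⟩
  -- Schwarz lemma for a function vanishing to second order at the origin.
  have := dist_le_mul_div_pow_of_mapsTo_ball_of_isLittleO (hLd.mono hsub) hmaps hlo hz'
  simpa [hL0] using this

/-- The Hadamard product of an even entire function of order one with simple zeros, in terms of the
factor that is left over when the zeros in the disc of radius `r` are divided out. -/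
lemma exists_hadamard_remainder {E : ℂ → ℂ} (hE : IsEntireOfOrderOne E)
    (heven : ∀ z, E (-z) = E z) (hsimple : ∀ z, E z = 0 → deriv E z ≠ 0) (hE0 : E 0 ≠ 0)
    {Z : ℝ → Finset ℂ} (hZ : ∀ r w, w ∈ Z r ↔ E w = 0 ∧ ‖w‖ < r) :
    ∃ F : ℝ → ℂ → ℂ, (∀ r, Differentiable ℂ (F r)) ∧ (∀ r z, E z = rootProd (Z r) z * F r z) ∧
      ∀ z, Tendsto (fun r ↦ F r z) atTop (𝓝 (E 0)) := by
  obtain ⟨hEd, hEgr⟩ := hE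
  -- the growth bound on circles
  obtain ⟨r₀, hr₀⟩ : ∃ r₀ : ℝ, ∀ z : ℂ, r₀ < ‖z‖ → ‖E z‖ ≤ Real.exp (‖z‖ ^ (1 + (1 / 2 : ℝ))) := by
    have h1 := hEgr (1 / 2) (by norm_num)
    rw [← Metric.cobounded_eq_cocompact, ← comap_norm_atTop, eventually_comap] at h1
    obtain ⟨a, ha⟩ := eventually_atTop.1 h1
    exact ⟨a, fun z hz ↦ ha _ hz.le z rfl⟩
  -- The error in the quotient is `O(M r / r²)`, so any growth exponent below 2 would do; `3 / 2` is
  -- used. The logarithm normalises the bound relative to `‖E 0‖`.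
  set M : ℝ → ℝ := fun r ↦ (2 * r) ^ (1 + (1 / 2 : ℝ)) + |Real.log ‖E 0‖| with hMdef
  have key : ∀ r : ℝ, ∃ F : ℂ → ℂ, Differentiable ℂ F ∧ (∀ z, E z = rootProd (Z r) z * F z) ∧
      (0 < r → r₀ < r → ∀ z, ‖z‖ < r / 2 →
        ∃ t, F z = E 0 * exp t ∧ ‖t‖ ≤ 2 * M r * (‖z‖ / (r / 2)) ^ 2) := by
    intro r
    by_cases h : 0 < r ∧ r₀ < r
    · have hMr : 0 < M r := by
        have : 0 < (2 * r) ^ (1 + (1 / 2 : ℝ)) := Real.rpow_pos_of_pos (by linarith [h.1]) _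
        positivity
      obtain ⟨F, h1, h2, h3⟩ := exists_quotient_near_const hEd heven hsimple hE0 h.1 hMr
        (fun z hz ↦ by
          have h4 := hr₀ z (by linarith [h.1, h.2])
          rw [hz] at h4
          calc ‖E z‖ ≤ _ := h4
            _ = Real.exp (Real.log ‖E 0‖) *
                Real.exp ((2 * r) ^ (1 + (1 / 2 : ℝ)) - Real.log ‖E 0‖) := by
              rw [← Real.exp_add]; ring_nf
            _ ≤ _ := by
              rw [Real.exp_log (norm_pos_iff.2 hE0)]
              gcongr
              simp only [hMdef]
              linarith [neg_abs_le (Real.log ‖E 0‖)]) (hZ r)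
      exact ⟨F, h1, h2, fun _ _ ↦ h3⟩
    -- For the remaining radii only the factorisation is needed, not the estimate.
    · obtain ⟨F, hF, hEF⟩ := exists_eq_rootProd_mul hEd (Z := Z r)
        (fun h0 ↦ hE0 ((hZ r 0).1 h0).1) (fun w hw ↦ ((hZ r w).1 hw).1)
      exact ⟨F, hF, hEF, fun h1 h2 ↦ absurd ⟨h1, h2⟩ h⟩
  choose F hF hEF ht using key
  refine ⟨F, hF, hEF, fun z ↦ ?_⟩
  have hM : Tendsto (fun r : ℝ ↦ 2 * M r * (‖z‖ / (r / 2)) ^ 2) atTop (𝓝 0) := by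
    have h1 : Tendsto (fun r : ℝ ↦ 8 * ‖z‖ ^ 2 * ((2 : ℝ) ^ (1 + (1 / 2 : ℝ)) * r ^ (-(1 / 2) : ℝ) +
        |Real.log ‖E 0‖| * r ^ (-2 : ℝ))) atTop
        (𝓝 (8 * ‖z‖ ^ 2 * ((2 : ℝ) ^ (1 + (1 / 2 : ℝ)) * 0 + |Real.log ‖E 0‖| * 0))) := by
      refine Tendsto.const_mul _ (Tendsto.add ?_ ?_)
      · exact (tendsto_rpow_neg_atTop (by norm_num)).const_mul _
      · exact (tendsto_rpow_neg_atTop (by norm_num)).const_mul _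
    simp only [mul_zero, add_zero] at h1
    refine h1.congr' ?_
    filter_upwards [eventually_gt_atTop 0] with r hr
    have e1 : r ^ (-(1 / 2) : ℝ) = r ^ (1 + (1 / 2 : ℝ)) * (r ^ 2)⁻¹ := by
      rw [← Real.rpow_natCast r 2, ← Real.rpow_neg hr.le, ← Real.rpow_add hr]
      norm_num
    have e2 : r ^ (-2 : ℝ) = (r ^ 2)⁻¹ := by
      rw [Real.rpow_neg hr.le]
      norm_num
    rw [e1, e2]
    simp only [hMdef]
    rw [Real.mul_rpow (by norm_num) hr.le]
    field_simp
    ring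
  have hlog : ∀ᶠ r in atTop, ∃ t, F r z = E 0 * exp t ∧ ‖t‖ ≤ 2 * M r * (‖z‖ / (r / 2)) ^ 2 := by
    filter_upwards [eventually_gt_atTop 0, eventually_gt_atTop r₀,
      eventually_gt_atTop (2 * ‖z‖)] with r h1 h2 h3
    exact ht r h1 h2 z (by linarith)
  exact tendsto_of_eventually_eq_mul_exp hlog hM

/-! ### Product formula for a meromorphic function with power-law behaviour -/

lemma logDeriv_rootProd {Z : Finset ℂ} (hZ : 0 ∉ Z) {z : ℂ} (hz : z ∉ Z) :
    logDeriv (rootProd Z) z = ∑ w ∈ Z, (z - w)⁻¹ := by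
  have hw0 : ∀ w ∈ Z, w ≠ 0 := fun w hw h0 ↦ hZ (h0 ▸ hw)
  have hzw : ∀ w ∈ Z, z - w ≠ 0 := fun w hw h0 ↦ hz (sub_eq_zero.1 h0 ▸ hw)
  have hne : ∀ w ∈ Z, 1 - z / w ≠ 0 := fun w hw h0 ↦ by
    have := hw0 w hw
    field_simp at h0
    exact hzw w hw (by linear_combination -h0)
  unfold rootProd
  rw [logDeriv_prod hne (fun w _ ↦ by fun_prop)]
  refine Finset.sum_congr rfl fun w hw ↦ ?_
  have h1 : HasDerivAt (fun z : ℂ ↦ 1 - z / w) (-(1 / w)) z :=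
    ((hasDerivAt_id z).div_const w).const_sub 1
  have h2 := hne w hw
  have h3 := hzw w hw
  have h4 := hw0 w hw
  rw [logDeriv_apply, h1.deriv]
  rw [div_eq_iff h2, eq_comm, inv_mul_eq_iff_eq_mul₀ h3]
  field_simp
  ring

/-- A bound for the logarithmic derivative on a circle excludes zeros and poles on it. -/
lemma meromorphicOrderAt_eq_zero_of_logDeriv_bound {H : ℂ → ℂ} (hH : Meromorphic H)
    (htop : ∀ x, meromorphicOrderAt H x ≠ ⊤) {r c : ℝ} (hr : 0 < r)
    (hc : ∀ z, ‖z‖ = r → ‖logDeriv H z‖ ≤ c) {x : ℂ} (hx : ‖x‖ = r) :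
    meromorphicOrderAt H x = 0 := by
  by_contra h
  -- At a zero or pole the logarithmic derivative has a simple pole, so it is unbounded along nearby
  -- points of the circle.
  have h1 := meromorphicOrderAt_logDeriv_eq_neg_one (hH x) h (htop x)
  have h2 := tendsto_norm_atTop_iff_cobounded.2
    (tendsto_cobounded_of_meromorphicOrderAt_neg (f := logDeriv H) (x := x) (by rw [h1]; decide))
  obtain ⟨z, hz1, hz2⟩ :=
    ((frequently_norm_eq hr hx).and_eventually (h2.eventually_gt_atTop c)).exists
  exact absurd (hc z hz1) (not_le.2 hz2)

/-- For distinct points, partial fractions give a difference of two equal integrals; for equal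
points, the integrand is `(z - a)⁻²`, which has a primitive. Hence zeros and poles inside the disc
drop out of the Cauchy integral of a logarithmic derivative. -/
lemma circleIntegral_inv_mul_inv {r : ℝ} {a b : ℂ} (ha : ‖a‖ < r) (hb : ‖b‖ < r) :
    (∮ z in C(0, r), (z - a)⁻¹ * (z - b)⁻¹) = 0 := by
  have hr : 0 < r := (norm_nonneg a).trans_lt ha
  rcases eq_or_ne a b with rfl | hab
  · have h1 := circleIntegral.integral_sub_zpow_of_ne (n := -2) (by decide) 0 a r
    rw [← h1]
    congr 1
    ext z
    rw [← mul_inv, ← sq, zpow_neg]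
    rfl
  · have hne : ∀ w : ℂ, ‖w‖ < r → ∀ z ∈ sphere (0 : ℂ) r, z - w ≠ 0 := fun w hw z hz h ↦ by
      rw [mem_sphere_zero_iff_norm, sub_eq_zero.1 h] at hz
      exact hw.ne hz
    have hint : ∀ w : ℂ, ‖w‖ < r → CircleIntegrable (fun z ↦ (z - w)⁻¹) 0 r := fun w hw ↦
      ContinuousOn.circleIntegrable hr.le
        (ContinuousOn.inv₀ (by fun_prop) (hne w hw))
    have h1 : (∮ z in C(0, r), (z - a)⁻¹ * (z - b)⁻¹) =
        ∮ z in C(0, r), (a - b)⁻¹ • ((z - a)⁻¹ - (z - b)⁻¹) := by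
      refine circleIntegral.integral_congr hr.le fun z hz ↦ ?_
      have e1 := hne a ha z hz
      have e2 := hne b hb z hz
      have e3 := sub_ne_zero.2 hab
      simp only [smul_eq_mul]
      field_simp
      ring
    rw [h1, circleIntegral.integral_smul, circleIntegral.integral_sub (hint a ha) (hint b hb),
      circleIntegral.integral_sub_inv_of_mem_ball (by simpa using ha),
      circleIntegral.integral_sub_inv_of_mem_ball (by simpa using hb), sub_self, smul_zero]

/-- A meromorphic function with simple zeros and poles, none of them on a circle, is in the disc
the ratio of the products over its zeros and poles, times a zero-free holomorphic function. -/
lemma exists_rootProd_ratio {H : ℂ → ℂ} (hH : Meromorphic H) (hp : HasSimplePoles H)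
    (hz : HasSimpleZeros H) (h0 : meromorphicOrderAt H 0 = 0) {r : ℝ}
    (hcirc : ∀ x, ‖x‖ = r → meromorphicOrderAt H x = 0) {A B : Finset ℂ}
    (hA : ∀ w, w ∈ A ↔ w ∈ poles H ∧ ‖w‖ < r) (hB : ∀ w, w ∈ B ↔ w ∈ zeros H ∧ ‖w‖ < r) :
    ∃ g : ℂ → ℂ, (∀ x, ‖x‖ ≤ r → AnalyticAt ℂ g x ∧ g x ≠ 0) ∧
      ∀ x, ∀ᶠ z in 𝓝[≠] x, H z * rootProd A z = rootProd B z * g z := by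
  classical
  have hA0 : (0 : ℂ) ∉ A := fun h ↦ by simpa [poles, h0] using ((hA 0).1 h).1
  have hB0 : (0 : ℂ) ∉ B := fun h ↦ by simpa [zeros, h0] using ((hB 0).1 h).1
  have hPm : ∀ Z : Finset ℂ, Meromorphic (rootProd Z) := fun Z x ↦
    (analyticAt_rootProd Z x).meromorphicAt
  obtain ⟨g, hg1, hg2, hg3⟩ := exists_removable_extension ((hH.mul (hPm A)).div (hPm B))
  -- In the open disc the products cancel the simple poles and zeros of `H`; on the circle there are
  -- none.
  have hord : ∀ x, ‖x‖ ≤ r → meromorphicOrderAt (H * rootProd A / rootProd B) x = 0 := by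
    intro x hx
    rw [meromorphicOrderAt_div ((hH x).mul (hPm A x)) (hPm B x),
      meromorphicOrderAt_mul (hH x) (hPm A x), meromorphicOrderAt_rootProd hA0,
      meromorphicOrderAt_rootProd hB0]
    rcases lt_trichotomy (meromorphicOrderAt H x) 0 with h | h | h
    · have hxr : ‖x‖ < r := lt_of_le_of_ne hx fun he ↦ by simp [hcirc x he] at h
      rw [if_pos ((hA x).2 ⟨h, hxr⟩), if_neg fun hx' ↦ not_lt_of_gt h ((hB x).1 hx').1, hp x h]
      rfl
    · rw [if_neg fun hx' ↦ ne_of_lt ((hA x).1 hx').1 h,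
        if_neg fun hx' ↦ ne_of_gt ((hB x).1 hx').1 h, h]
      rfl
    · have hxr : ‖x‖ < r := lt_of_le_of_ne hx fun he ↦ by simp [hcirc x he] at h
      rw [if_neg fun hx' ↦ not_lt_of_gt h ((hA x).1 hx').1, if_pos ((hB x).2 ⟨h, hxr⟩), hz x h]
      rfl
  refine ⟨g, fun x hx ↦ ⟨hg2 x (hord x hx).ge, hg3 x (hord x hx)⟩, fun x ↦ ?_⟩
  have hBne : ∀ᶠ z in 𝓝[≠] x, rootProd B z ≠ 0 := by
    refine (meromorphicOrderAt_ne_top_iff_eventually_ne_zero (hPm B x)).1 ?_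
    rw [meromorphicOrderAt_rootProd hB0]
    split_ifs <;> decide
  filter_upwards [hg1 x, hBne] with z h1 h2
  rw [← h1]
  simp only [Pi.div_apply, Pi.mul_apply]
  field_simp

/-- In the disc, the logarithmic derivative of the zero-free factor is controlled by the
logarithmic derivative of the function on the circle. -/
lemma norm_logDeriv_le_of_ratio {H g : ℂ → ℂ} (hH : Meromorphic H)
    (htop : ∀ x, meromorphicOrderAt H x ≠ ⊤) {r c : ℝ} (hr : 0 < r)
    (hc : ∀ z, ‖z‖ = r → ‖logDeriv H z‖ ≤ c) {A B : Finset ℂ}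
    (hA0 : 0 ∉ A) (hB0 : 0 ∉ B) (hA : ∀ w ∈ A, ‖w‖ < r) (hB : ∀ w ∈ B, ‖w‖ < r)
    (hg : ∀ x, ‖x‖ ≤ r → AnalyticAt ℂ g x ∧ g x ≠ 0)
    (hHg : ∀ x, ∀ᶠ z in 𝓝[≠] x, H z * rootProd A z = rootProd B z * g z) {x : ℂ} (hx : ‖x‖ < r) :
    ‖logDeriv g x‖ ≤ r * (c / (r - ‖x‖)) := by
  -- `Q` is the logarithmic derivative of `H` off isolated points, written so that it is continuous
  -- on the circle. There `H` itself may carry arbitrary values.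
  set Q : ℂ → ℂ := fun z ↦ logDeriv g z + (∑ w ∈ B, (z - w)⁻¹ - ∑ w ∈ A, (z - w)⁻¹) with hQ
  have hne : ∀ w : ℂ, ‖w‖ < r → ∀ z : ℂ, ‖z‖ = r → z - w ≠ 0 := fun w hw z hz h ↦ by
    rw [sub_eq_zero.1 h] at hz
    exact hw.ne hz
  have hldan : ∀ z, ‖z‖ ≤ r → AnalyticAt ℂ (logDeriv g) z := fun z hz ↦
    (hg z hz).1.deriv.div (hg z hz).1 (hg z hz).2
  have hsum : ∀ Z : Finset ℂ, (∀ w ∈ Z, ‖w‖ < r) → ∀ z : ℂ, ‖z‖ = r →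
      ContinuousAt (fun z ↦ ∑ w ∈ Z, (z - w)⁻¹) z := fun Z hZ z hz ↦
    tendsto_finsetSum _ fun w hw ↦
      ContinuousAt.inv₀ (f := fun z ↦ z - w) (by fun_prop) (hne w (hZ w hw) z hz)
  have hQc : ∀ z, ‖z‖ = r → ContinuousAt Q z := fun z hz ↦
    (hldan z hz.le).continuousAt.add ((hsum B hB z hz).sub (hsum A hA z hz))
  have hQb : ∀ z, ‖z‖ = r → ‖Q z‖ ≤ c := by
    intro y hy
    have hZe : ∀ Z : Finset ℂ, (∀ w ∈ Z, ‖w‖ < r) → ∀ᶠ z in 𝓝 y, z ∉ Z := fun Z hZ ↦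
      Z.finite_toSet.isClosed.isOpen_compl.mem_nhds fun h ↦ (hZ y h).ne hy
    have hev : ∀ᶠ z in 𝓝[≠] y, logDeriv H z = Q z := by
      filter_upwards [(hH y).eventually_analyticAt,
        (meromorphicOrderAt_ne_top_iff_eventually_ne_zero (hH y)).1 (htop y),
        (logDeriv_congr_nhdsNE (f := H * rootProd A) (g := rootProd B * g) (hHg y)),
        (hg y hy.le).1.eventually_analyticAt.filter_mono nhdsWithin_le_nhds,
        ((hg y hy.le).1.continuousAt.eventually_ne (hg y hy.le).2).filter_mono nhdsWithin_le_nhds,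
        (hZe A hA).filter_mono nhdsWithin_le_nhds, (hZe B hB).filter_mono nhdsWithin_le_nhds]
        with z h1 h2 h3 h4 h5 h6 h7
      rw [show H * rootProd A = fun z ↦ H z * rootProd A z from rfl,
        show rootProd B * g = fun z ↦ rootProd B z * g z from rfl,
        logDeriv_mul z h2 (fun h ↦ h6 ((rootProd_eq_zero_iff hA0).1 h)) h1.differentiableAt
          (differentiable_rootProd A z),
        logDeriv_mul z (fun h ↦ h7 ((rootProd_eq_zero_iff hB0).1 h)) h5
          (differentiable_rootProd B z) h4.differentiableAt,
        logDeriv_rootProd hA0 h6, logDeriv_rootProd hB0 h7] at h3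
      simp only [hQ]
      linear_combination h3
    -- If the bound failed at `y`, continuity would make it fail at nearby points of the circle
    -- where `Q` equals `logDeriv H`.
    by_contra hlt
    rw [not_le] at hlt
    have h1 : ∀ᶠ z in 𝓝[≠] y, c < ‖Q z‖ :=
      ((hQc y hy).norm.eventually_const_lt hlt).filter_mono nhdsWithin_le_nhds
    obtain ⟨z, hz1, hz2, hz3⟩ :=
      ((frequently_norm_eq hr hy).and_eventually (h1.and hev)).exists
    exact absurd (hc z hz1) (not_le.2 (hz3 ▸ hz2))
  have hci : ∀ f : ℂ → ℂ, (∀ z, ‖z‖ = r → ContinuousAt f z) →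
      CircleIntegrable (fun z ↦ (z - x)⁻¹ • f z) 0 r := fun f hf ↦
    ContinuousOn.circleIntegrable hr.le fun z hz ↦ by
      rw [mem_sphere_zero_iff_norm] at hz
      exact ((ContinuousAt.inv₀ (f := fun z ↦ z - x) (by fun_prop) (hne x hx z hz)).smul
        (hf z hz)).continuousWithinAt
  have hzero : ∀ Z : Finset ℂ, (∀ w ∈ Z, ‖w‖ < r) →
      (∮ z in C(0, r), (z - x)⁻¹ • ∑ w ∈ Z, (z - w)⁻¹) = 0 := by
    intro Z hZ
    simp only [smul_eq_mul, Finset.mul_sum]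
    rw [circleIntegral.integral_fun_sum fun w hw ↦ by
      exact hci (fun z ↦ (z - w)⁻¹) fun z hz ↦
        ContinuousAt.inv₀ (f := fun z ↦ z - w) (by fun_prop) (hne w (hZ w hw) z hz)]
    exact Finset.sum_eq_zero fun w hw ↦ circleIntegral_inv_mul_inv hx (hZ w hw)
  -- Cauchy's formula for `logDeriv g` may be written with `Q`, because the sums over `A` and `B`
  -- integrate to zero. The bound on the circle thus applies directly.
  have hcauchy : (2 * Real.pi * I : ℂ)⁻¹ • (∮ z in C(0, r), (z - x)⁻¹ • Q z) = logDeriv g x := by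
    have h1 : (∮ z in C(0, r), (z - x)⁻¹ • Q z) =
        ∮ z in C(0, r), (z - x)⁻¹ • logDeriv g z := by
      simp only [hQ, smul_add, smul_sub]
      rw [circleIntegral.integral_add (hci _ fun z hz ↦ (hldan z hz.le).continuousAt)
        ((hci _ (hsum B hB)).fun_sub (hci _ (hsum A hA))),
        circleIntegral.integral_sub (hci _ (hsum B hB)) (hci _ (hsum A hA)), hzero A hA, hzero B hB]
      simp
    rw [h1]
    refine two_pi_I_inv_smul_circleIntegral_sub_inv_smul_of_differentiable_on_off_countable
      Set.countable_empty (by simpa using hx) (fun z hz ↦ ?_) fun z hz ↦ ?_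
    · exact (hldan z (by simpa using hz)).continuousAt.continuousWithinAt
    · have hz' : ‖z‖ < r := by simpa using hz.1
      exact (hldan z hz'.le).differentiableAt
  rw [← hcauchy]
  refine circleIntegral.norm_two_pi_i_inv_smul_integral_le_of_norm_le_const hr.le fun z hz ↦ ?_
  rw [mem_sphere_zero_iff_norm] at hz
  have h1 : r - ‖x‖ ≤ ‖z - x‖ := hz ▸ norm_sub_norm_le z x
  have h2 := hQb z hz
  rw [norm_smul, norm_inv, inv_mul_eq_div]
  exact div_le_div₀ ((norm_nonneg _).trans h2) h2 (by linarith) h1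

/-- Near the origin, a meromorphic function is close to its value at the origin times the ratio of
the products over its zeros and poles in a disc, if its logarithmic derivative is small on the
boundary. -/
lemma exists_ratio_near_const {H : ℂ → ℂ} (hH : Meromorphic H)
    (htop : ∀ x, meromorphicOrderAt H x ≠ ⊤) (hp : HasSimplePoles H) (hz : HasSimpleZeros H)
    (h0 : AnalyticAt ℂ H 0) (h0' : H 0 ≠ 0) {r c : ℝ} (hr : 0 < r)
    (hc : ∀ z, ‖z‖ = r → ‖logDeriv H z‖ ≤ c) {A B : Finset ℂ}
    (hA : ∀ w, w ∈ A ↔ w ∈ poles H ∧ ‖w‖ < r) (hB : ∀ w, w ∈ B ↔ w ∈ zeros H ∧ ‖w‖ < r) :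
    ∃ g : ℂ → ℂ, (∀ x, ‖x‖ < r → ContinuousAt g x) ∧
      (∀ x, ∀ᶠ z in 𝓝[≠] x, H z * rootProd A z = rootProd B z * g z) ∧
      ∀ z, ‖z‖ < r / 2 → ∃ t, g z = H 0 * exp t ∧ ‖t‖ ≤ 2 * c * ‖z‖ := by
  have hord0 : meromorphicOrderAt H 0 = 0 := by
    rw [h0.meromorphicOrderAt_eq, h0.analyticOrderAt_eq_zero.2 h0']
    rfl
  have hA0 : (0 : ℂ) ∉ A := fun h ↦ by simpa [poles, hord0] using ((hA 0).1 h).1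
  have hB0 : (0 : ℂ) ∉ B := fun h ↦ by simpa [zeros, hord0] using ((hB 0).1 h).1
  obtain ⟨g, hg, hHg⟩ := exists_rootProd_ratio hH hp hz hord0
    (fun x hx ↦ meromorphicOrderAt_eq_zero_of_logDeriv_bound hH htop hr hc hx) hA hB
  have hb := fun {x : ℂ} ↦ norm_logDeriv_le_of_ratio (x := x) hH htop hr hc hA0 hB0
    (fun w hw ↦ ((hA w).1 hw).2) (fun w hw ↦ ((hB w).1 hw).2) hg hHg
  have hg0 : g 0 = H 0 := by
    have := eq_of_eventuallyEq_nhdsNE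
      (f := fun z ↦ H z * rootProd A z) (g := fun z ↦ rootProd B z * g z)
      (h0.continuousAt.mul (differentiable_rootProd A).continuous.continuousAt)
      ((differentiable_rootProd B).continuous.continuousAt.mul
        (hg 0 (by simpa using hr.le)).1.continuousAt) (hHg 0)
    simpa [rootProd_zero] using this.symm
  refine ⟨g, fun x hx ↦ (hg x hx.le).1.continuousAt, hHg, ?_⟩
  have hmem : ∀ z ∈ ball (0 : ℂ) (r / 2), ‖z‖ < r / 2 := fun z hz ↦ by simpa using hz
  obtain ⟨L, hL, hL0, hgL⟩ := exists_log_on_ball (half_pos hr)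
    (fun z hz ↦ (hg z (by linarith [hmem z hz])).1.differentiableAt.differentiableWithinAt)
    (fun z hz ↦ (hg z (by linarith [hmem z hz])).2)
  have hc0 : 0 ≤ c := (norm_nonneg _).trans (hc (r : ℂ) (by simp [abs_of_pos hr]))
  intro z hz
  have hz' : z ∈ ball (0 : ℂ) (r / 2) := by simpa using hz
  refine ⟨L z, by rw [hgL z hz', hg0], ?_⟩
  -- Mean value inequality: on the half disc `r * (c / (r - ‖w‖)) ≤ 2 * c`.
  have h1 := (convex_ball (0 : ℂ) (r / 2)).norm_image_sub_le_of_norm_hasDerivWithin_le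
    (C := 2 * c) (fun w hw ↦ (hL w hw).hasDerivWithinAt) (fun w hw ↦ ?_)
    (mem_ball_self (half_pos hr)) hz'
  · simpa [hL0] using h1
  · have h2 := hmem w hw
    refine (hb (by linarith)).trans ?_
    rw [mul_div_assoc', div_le_iff₀ (by linarith)]
    nlinarith

/-- The product formula for a meromorphic function with power-law behaviour. -/
lemma exists_ratio_remainder {H : ℂ → ℂ} (hH : Meromorphic H)
    (htop : ∀ x, meromorphicOrderAt H x ≠ ⊤) (hp : HasSimplePoles H) (hz : HasSimpleZeros H)
    (h0 : AnalyticAt ℂ H 0) (h0' : H 0 ≠ 0) {R : ℕ → ℝ} (hR : IsRadialSequence R)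
    (hpl : HasPowerLaw R H) {A B : ℕ → Finset ℂ}
    (hA : ∀ N w, w ∈ A N ↔ w ∈ poles H ∧ ‖w‖ < R N)
    (hB : ∀ N w, w ∈ B N ↔ w ∈ zeros H ∧ ‖w‖ < R N) :
    ∃ g : ℕ → ℂ → ℂ, (∀ N x, ‖x‖ < R N → ContinuousAt (g N) x) ∧
      (∀ N x, ∀ᶠ z in 𝓝[≠] x, H z * rootProd (A N) z = rootProd (B N) z * g N z) ∧
      ∀ z, Tendsto (fun N ↦ g N z) atTop (𝓝 (H 0)) := by
  obtain ⟨C, hC⟩ := hpl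
  choose g hg1 hg2 hg3 using fun N ↦
    exists_ratio_near_const hH htop hp hz h0 h0' (hR.pos N) (hC N) (hA N) (hB N)
  refine ⟨g, hg1, hg2, fun z ↦ tendsto_of_eventually_eq_mul_exp (b := fun N ↦ 2 * (C / R N) * ‖z‖)
    ?_ ?_⟩
  · filter_upwards [hR.tendsto.eventually_gt_atTop (2 * ‖z‖)] with N hN
    exact hg3 N z (by linarith)
  · have : Tendsto (fun N ↦ 2 * (C / R N) * ‖z‖) atTop (𝓝 (2 * 0 * ‖z‖)) :=
      ((hR.tendsto.const_div_atTop C).const_mul 2).mul_const _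
    simpa using this

/-! ### Orders, reflection, and finiteness of zeros and poles in discs -/

lemma eventually_nhdsNE_of_codiscrete {p : ℂ → Prop} (h : ∀ᶠ z in codiscrete ℂ, p z) (x : ℂ) :
    ∀ᶠ z in 𝓝[≠] x, p z := by
  have := mem_codiscrete.1 h x
  rw [disjoint_principal_right, compl_compl] at this
  exact this

lemma eventually_nhdsNE_neg {p : ℂ → Prop} {x : ℂ} (h : ∀ᶠ z in 𝓝[≠] (-x), p z) :
    ∀ᶠ z in 𝓝[≠] x, p (-z) := by
  have : Tendsto (fun z : ℂ ↦ -z) (𝓝[≠] x) (𝓝[≠] (-x)) :=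
    tendsto_nhdsWithin_of_tendsto_nhds_of_eventually_within _
      (continuous_neg.continuousAt.tendsto.mono_left nhdsWithin_le_nhds)
      (by filter_upwards [self_mem_nhdsWithin] with z hz using fun h' ↦ hz (neg_injective h'))
  exact this.eventually h

lemma meromorphicOrderAt_eq_zero_of_ne_zero {f : ℂ → ℂ} {x : ℂ} (hf : AnalyticAt ℂ f x)
    (h : f x ≠ 0) : meromorphicOrderAt f x = 0 := by
  rw [hf.meromorphicOrderAt_eq, hf.analyticOrderAt_eq_zero.2 h]
  rfl

lemma meromorphicOrderAt_ne_top_of_ne_zero {f : ℂ → ℂ} (hf : Meromorphic f) {x : ℂ}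
    (hx : AnalyticAt ℂ f x) (h : f x ≠ 0) (y : ℂ) : meromorphicOrderAt f y ≠ ⊤ :=
  (meromorphicOn_univ.2 hf).meromorphicOrderAt_ne_top_of_isPreconnected isPreconnected_univ
    (Set.mem_univ x) (Set.mem_univ y)
    (by rw [meromorphicOrderAt_eq_zero_of_ne_zero hx h]; exact WithTop.zero_ne_top)

lemma meromorphicOrderAt_comp_neg (f : ℂ → ℂ) (x : ℂ) :
    meromorphicOrderAt (fun z ↦ f (-z)) x = meromorphicOrderAt f (-x) :=
  meromorphicOrderAt_comp_of_deriv_ne_zero (f := f) (g := fun z : ℂ ↦ -z) (by fun_prop) (by simp)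

/-- A meromorphic function has finitely many zeros and poles in a disc. -/
lemma finite_order_ne_zero {f : ℂ → ℂ} (hf : Meromorphic f)
    (htop : ∀ x, meromorphicOrderAt f x ≠ ⊤) (r : ℝ) :
    {w : ℂ | meromorphicOrderAt f w ≠ 0 ∧ ‖w‖ < r}.Finite := by
  have h1 := (show MeromorphicOn f (closedBall (0 : ℂ) r) from fun x _ ↦
    hf x).codiscreteWithin_setOfPred_meromorphicOrderAt_eq_zero_or_top fun x _ ↦ htop x
  refine ((isCompact_closedBall (0 : ℂ) r).finite_sdiff_of_mem_codiscreteWithin h1).subset ?_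
  rintro w ⟨hw, hwr⟩
  refine ⟨by simpa using hwr.le, fun h ↦ ?_⟩
  rcases h.2 with h | h
  · exact hw h
  · exact htop w h

lemma exists_finset_of_order_ne_zero {f : ℂ → ℂ} (hf : Meromorphic f)
    (htop : ∀ x, meromorphicOrderAt f x ≠ ⊤) {s : Set ℂ}
    (hs : ∀ w ∈ s, meromorphicOrderAt f w ≠ 0) (r : ℝ) :
    ∃ Z : Finset ℂ, ∀ w, w ∈ Z ↔ w ∈ s ∧ ‖w‖ < r := by
  have hfin : {w : ℂ | w ∈ s ∧ ‖w‖ < r}.Finite :=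
    (finite_order_ne_zero hf htop r).subset fun w hw ↦ ⟨hs w hw.1, hw.2⟩
  exact ⟨hfin.toFinset, by simp⟩

lemma partialProd_eq_rootProd {s : Set ℂ} {r : ℝ} {Z : Finset ℂ}
    (hZ : ∀ w, w ∈ Z ↔ w ∈ s ∧ ‖w‖ < r) (z : ℂ) : partialProd s r z = rootProd Z z := by
  have : {w : ℂ | w ∈ s ∧ ‖w‖ < r} = (Z : Set ℂ) := by
    ext w
    simp [hZ]
  rw [partialProd, this, finprod_mem_coe_finset, rootProd]

/-- The disjoint set of mirror images contributes the factors `1 + z / w`. This splits the Hadamard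
product of `E` into a pole part and its reflection. -/
lemma rootProd_eq_mul_of_neg {A Z : Finset ℂ} (hdisj : ∀ w ∈ A, -w ∉ A)
    (hZ : ∀ w, w ∈ Z ↔ w ∈ A ∨ -w ∈ A) (z : ℂ) :
    rootProd Z z = rootProd A z * rootProd A (-z) := by
  classical
  have h1 : Z = A ∪ A.image (fun w ↦ -w) := by
    ext w
    simp [hZ, neg_eq_iff_eq_neg]
  have h2 : Disjoint A (A.image fun w ↦ -w) := by
    rw [Finset.disjoint_left]
    intro w hw hw'
    obtain ⟨v, hv, rfl⟩ := Finset.mem_image.1 hw'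
    exact hdisj v hv hw
  rw [h1, rootProd, Finset.prod_union h2, Finset.prod_image (fun _ _ _ _ h ↦ neg_injective h)]
  refine congrArg _ (Finset.prod_congr rfl fun w _ ↦ ?_)
  rw [neg_div, div_neg]

lemma eventually_sinh_ne_zero {β : ℝ} (hβ : 0 < β) (x : ℂ) :
    ∀ᶠ z in 𝓝[≠] x, sinh (β * z / 2) ≠ 0 := by
  have hd : Differentiable ℂ fun z : ℂ ↦ sinh (β * z / 2) := by fun_prop
  rcases (hd.analyticAt x).eventually_eq_zero_or_eventually_ne_zero with h | h
  · exfalso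
    have h1 : (fun z : ℂ ↦ sinh (β * z / 2)) = fun _ ↦ 0 :=
      AnalyticOnNhd.eq_of_eventuallyEq (fun z _ ↦ hd.analyticAt z) analyticOnNhd_const h
    have h2 := congrFun h1 ((2 / β : ℝ) : ℂ)
    have h3 : (β : ℂ) * ((2 / β : ℝ) : ℂ) / 2 = ((1 : ℝ) : ℂ) := by
      have : (β : ℂ) ≠ 0 := by exact_mod_cast hβ.ne'
      push_cast
      field_simp
    simp only [h3] at h2
    rw [← ofReal_sinh, ofReal_eq_zero, Real.sinh_eq_zero] at h2
    exact one_ne_zero h2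
  · exact h

/-! ### The entire function of a thermal correlator -/

lemma IsRetardedCorrelator.im_neg {G : ℂ → ℂ} (hG : IsRetardedCorrelator G) {w : ℂ}
    (hw : w ∈ poles G) : w.im < 0 := by
  by_contra h
  exact absurd (hG.analyticAt w (not_lt.1 h)).meromorphicOrderAt_nonneg (not_le.2 hw)

/-- The entire function of the thermal product hypothesis is even, vanishes exactly at the poles
and their mirror images, and determines the thermal coefficient. -/
lemma exists_thermal_entire {β : ℝ} (hβ : 0 < β) {G : ℂ → ℂ} (hG : IsRetardedCorrelator G)
    (hT : ThermalProductHypothesis β G) :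
    ∃ E : ℂ → ℂ, IsEntireOfOrderOne E ∧ (∀ z, E (-z) = E z) ∧ (∀ z, E z = 0 → deriv E z ≠ 0) ∧
      (∀ z, E z = 0 ↔ z ∈ poles G ∨ -z ∈ poles G) ∧
      (∀ x, ∀ᶠ z in 𝓝[≠] x, E z * (G z - G (-z)) = 2 * I * sinh (β * z / 2)) ∧
      E 0 * thermalCoeff β G = 1 := by
  obtain ⟨E, hE, hEρ, hE0⟩ := hT
  have hEG : ∀ x, ∀ᶠ z in 𝓝[≠] x, E z * (G z - G (-z)) = 2 * I * sinh (β * z / 2) := by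
    intro x
    filter_upwards [eventually_nhdsNE_of_codiscrete hEρ x] with z hz
    rw [← hz, spectralDensity]
    field_simp
  have hβ' : (β : ℂ) ≠ 0 := by exact_mod_cast hβ.ne'
  -- Off isolated points `E` is a quotient of two odd functions; continuity covers the rest.
  have heven : ∀ z, E (-z) = E z := by
    intro x
    have hc := hE.1.continuous
    refine eq_of_eventuallyEq_nhdsNE (f := fun z ↦ E (-z)) (by fun_prop) (by fun_prop) ?_
    filter_upwards [hEG x, eventually_nhdsNE_neg (hEG (-x)), eventually_sinh_ne_zero hβ x]
      with z h1 h2 h3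
    rw [neg_neg, mul_neg, neg_div, sinh_neg] at h2
    have h4 : G z - G (-z) ≠ 0 := fun h ↦ by
      rw [h, mul_zero] at h1
      exact mul_ne_zero (mul_ne_zero two_ne_zero I_ne_zero) h3 h1.symm
    refine mul_right_cancel₀ h4 ?_
    linear_combination -h2 - h1
  -- The mirror image of a pole lies in the upper half-plane, where `G` is holomorphic. If `E x ≠
  -- 0`, then `G z = G (-z) + 2 i sinh (β z / 2) / E z` near `x`, so there would be no pole.
  have hzero : ∀ z ∈ poles G, E z = 0 := by
    intro x hx
    by_contra hne
    have ha : AnalyticAt ℂ G (-x) := hG.analyticAt _ (by simpa using (hG.im_neg hx).le)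
    have ha' : AnalyticAt ℂ (fun z ↦ G (-z) + 2 * I * sinh (β * z / 2) / E z) x := by
      have h1 : AnalyticAt ℂ (fun z ↦ G (-z)) x :=
        AnalyticAt.fun_comp (f := fun z : ℂ ↦ -z) ha (by fun_prop)
      have h2 : AnalyticAt ℂ (fun z : ℂ ↦ 2 * I * sinh (β * z / 2)) x :=
        (show Differentiable ℂ fun z : ℂ ↦ 2 * I * sinh (β * z / 2) by fun_prop).analyticAt x
      exact h1.add (h2.div (hE.1.analyticAt x) hne)
    have hev : G =ᶠ[𝓝[≠] x] fun z ↦ G (-z) + 2 * I * sinh (β * z / 2) / E z := by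
      filter_upwards [hEG x,
        (hE.1.continuous.continuousAt.eventually_ne hne).filter_mono nhdsWithin_le_nhds]
        with z h1 h2
      rw [← h1]
      field_simp
      ring
    have h1 := ha'.meromorphicOrderAt_nonneg
    rw [← meromorphicOrderAt_congr hev] at h1
    exact absurd h1 (not_le.2 hx)
  refine ⟨E, hE, heven, fun z hz ↦ (hE0 z hz).1, fun z ↦ ⟨fun h ↦ (hE0 z h).2, ?_⟩, hEG, ?_⟩
  · rintro (h | h)
    · exact hzero z h
    · rw [← heven]
      exact hzero _ h
  -- Differentiating `E(z) (G(z) - G(-z)) = 2 i sinh (β z / 2)` at 0 gives `2 E(0) G'(0) = i β`.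
  · have hG0 : AnalyticAt ℂ G 0 := hG.analyticAt 0 (by simp)
    have hGd : HasDerivAt G (deriv G 0) 0 := hG0.differentiableAt.hasDerivAt
    have hGn : HasDerivAt (fun z ↦ G (-z)) (-deriv G 0) 0 := by
      have h1 : HasDerivAt G (deriv G 0) (-0) := by simpa using hGd
      simpa [Function.comp_def] using h1.scomp (0 : ℂ) (hasDerivAt_neg (0 : ℂ))
    have h1 : HasDerivAt (fun z ↦ E z * (G z - G (-z)))
        (deriv E 0 * (G 0 - G (-0)) + E 0 * (deriv G 0 - -deriv G 0)) 0 :=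
      (hE.1 0).hasDerivAt.mul (hGd.sub hGn)
    have h2 : HasDerivAt (fun z : ℂ ↦ 2 * I * sinh (β * z / 2))
        (2 * I * (cosh (β * 0 / 2) * (β * 1 / 2))) 0 :=
      ((((hasDerivAt_id (0 : ℂ)).const_mul (β : ℂ)).div_const 2).csinh).const_mul _
    have hev : (fun z ↦ E z * (G z - G (-z))) =ᶠ[𝓝 0] fun z ↦ 2 * I * sinh (β * z / 2) :=
      (h1.continuousAt.eventuallyEq_nhds_iff_eventuallyEq_nhdsNE h2.continuousAt).1 (hEG 0)
    have h3 := h1.unique (h2.congr_of_eventuallyEq hev)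
    simp only [mul_zero, zero_div, cosh_zero, neg_zero, sub_self, zero_add] at h3
    rw [thermalCoeff]
    field_simp
    linear_combination h3

/-! ### The duality relation for an auxiliary meromorphic function -/

/-- The duality relation follows from the product formula for a meromorphic function `H` whose odd
part is proportional to the spectral density. -/
lemma spectralDualityRelation_of_remainder {β : ℝ} (hβ : 0 < β) {G : ℂ → ℂ}
    (hG : IsRetardedCorrelator G) (hT : ThermalProductHypothesis β G) {R : ℕ → ℝ}
    (hR : IsRadialSequence R) {H : ℂ → ℂ} (hH : Meromorphic H) (hH0 : H 0 ≠ 0) {c : ℂ}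
    (hord : ∀ x, 0 ≤ meromorphicOrderAt H x ∨ x ∈ poles G ∧ meromorphicOrderAt H x = -1)
    (hHG : ∀ x, ∀ᶠ z in 𝓝[≠] x, H z - H (-z) = c * (G z - G (-z)))
    {s : Set ℂ} {A B : ℕ → Finset ℂ} (hA : ∀ N w, w ∈ A N ↔ w ∈ poles G ∧ ‖w‖ < R N)
    (hB : ∀ N w, w ∈ B N ↔ w ∈ s ∧ ‖w‖ < R N) {g : ℕ → ℂ → ℂ}
    (hgc : ∀ N x, ‖x‖ < R N → ContinuousAt (g N) x)
    (hg : ∀ N x, ∀ᶠ z in 𝓝[≠] x, H z * rootProd (A N) z = rootProd (B N) z * g N z)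
    (hglim : ∀ z, Tendsto (fun N ↦ g N z) atTop (𝓝 (H 0))) :
    SpectralDualityRelation β R (poles G) s (-c * thermalCoeff β G / H 0) := by
  obtain ⟨E, hE, heven, hsimple, hEz, hEG, hE0⟩ := exists_thermal_entire hβ hG hT
  have hE0' : E 0 ≠ 0 := left_ne_zero_of_mul_eq_one hE0
  have hEm : Meromorphic E := fun x ↦ (hE.1.analyticAt x).meromorphicAt
  have hEtop := meromorphicOrderAt_ne_top_of_ne_zero hEm (hE.1.analyticAt 0) hE0'
  have hEpos : ∀ w, E w = 0 → 0 < meromorphicOrderAt E w := fun w hw ↦ by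
    refine lt_of_le_of_ne (hE.1.analyticAt w).meromorphicOrderAt_nonneg fun h ↦ ?_
    exact (hE.1.analyticAt w).meromorphicNFAt.meromorphicOrderAt_eq_zero_iff.1 h.symm hw
  choose Z hZ using exists_finset_of_order_ne_zero hEm hEtop (s := {w | E w = 0})
    (fun w hw ↦ (hEpos w hw).ne')
  obtain ⟨F, hFd, hEF, hFlim⟩ := exists_hadamard_remainder hE heven hsimple hE0' hZ
  -- All poles lie in the open lower half-plane, so none is the mirror image of another.
  have hZA : ∀ N z, rootProd (Z (R N)) z = rootProd (A N) z * rootProd (A N) (-z) := fun N z ↦ by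
    refine rootProd_eq_mul_of_neg (fun w hw hw' ↦ ?_) (fun w ↦ ?_) z
    · have h1 := hG.im_neg ((hA N w).1 hw).1
      have h2 := hG.im_neg ((hA N _).1 hw').1
      rw [neg_im] at h2
      linarith
    · rw [hZ, hA, hA, norm_neg, Set.mem_ofPred_eq, hEz]
      tauto
  have hHn : Meromorphic fun z ↦ H (-z) := fun x ↦
    (hH (-x)).comp_analyticAt (g := fun z : ℂ ↦ -z) (by fun_prop)
  -- `K` is `E(z) H(-z)` with its singularities removed: each simple pole of `H(-z)` meets a zero of
  -- `E`.
  obtain ⟨K, hK, hKa, -⟩ := exists_removable_extension (hEm.mul hHn)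
  have hKc : ∀ x, ContinuousAt K x := by
    refine fun x ↦ (hKa x ?_).continuousAt
    rw [meromorphicOrderAt_mul (hEm x) (hHn x), meromorphicOrderAt_comp_neg]
    rcases hord (-x) with h | ⟨h, h'⟩
    · exact add_nonneg (hE.1.analyticAt x).meromorphicOrderAt_nonneg h
    · have h1 := hEpos x ((hEz x).2 (Or.inr h))
      rw [h']
      lift meromorphicOrderAt E x to ℤ using hEtop x with n hn
      have h2 : 0 < n := WithTop.coe_lt_coe.1 h1
      exact WithTop.coe_le_coe.2 (show 0 ≤ n + -1 by lia)
  -- The product over `A N` at `-z` occurs in `E(z)` and clears the denominator of `H(-z)`, so no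
  -- division is needed.
  have hprod : ∀ N z, ‖z‖ < R N →
      rootProd (A N) z * rootProd (B N) (-z) * (F (R N) z * g N (-z)) = K z := by
    intro N x hx
    have hd := fun Y ↦ (differentiable_rootProd Y).continuous
    have hdA := hd (A N)
    have hdB := hd (B N)
    have hFc := (hFd (R N)).continuous
    have hgn : ContinuousAt (fun z ↦ g N (-z)) x :=
      ContinuousAt.comp (f := fun z : ℂ ↦ -z) (hgc N (-x) (by rwa [norm_neg])) (by fun_prop)
    refine eq_of_eventuallyEq_nhdsNE
      (f := fun z ↦ rootProd (A N) z * rootProd (B N) (-z) * (F (R N) z * g N (-z)))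
      (ContinuousAt.mul (by fun_prop) (hFc.continuousAt.mul hgn)) (hKc x) ?_
    filter_upwards [hK x, eventually_nhdsNE_neg (hg N (-x))] with z h1 h2
    rw [← h1, Pi.mul_apply, hEF (R N) z, hZA]
    linear_combination -(rootProd (A N) z * F (R N) z) * h2
  refine ⟨fun z ↦ K z / (E 0 * H 0), fun z ↦ ?_, fun x ↦ ?_⟩
  · have hlim : Tendsto (fun N ↦ F (R N) z * g N (-z)) atTop (𝓝 (E 0 * H 0)) :=
      ((hFlim z).comp hR.tendsto).mul (hglim (-z))
    refine ((tendsto_const_nhds (x := K z)).div hlim (mul_ne_zero hE0' hH0)).congr' ?_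
    filter_upwards [Tendsto.eventually_ne hlim (mul_ne_zero hE0' hH0),
      hR.tendsto.eventually_gt_atTop ‖z‖] with N h1 h2
    rw [partialProd_eq_rootProd (hA N), partialProd_eq_rootProd (hB N), Pi.div_apply, div_eq_iff h1,
      hprod N z h2]
  · have hKodd : K x - K (-x) = -c * (2 * I * sinh (β * x / 2)) := by
      refine eq_of_eventuallyEq_nhdsNE (f := fun z ↦ K z - K (-z))
        (g := fun z ↦ -c * (2 * I * sinh (β * z / 2))) ((hKc x).sub
          (ContinuousAt.comp (f := fun z : ℂ ↦ -z) (hKc (-x)) (by fun_prop))) (by fun_prop) ?_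
      filter_upwards [hK x, eventually_nhdsNE_neg (hK (-x)), hHG x, hEG x] with z h1 h2 h3 h4
      rw [← h1, ← h2, ← h4]
      simp only [Pi.mul_apply, neg_neg, heven]
      linear_combination -E z * h3
    rw [← sub_div, hKodd, div_eq_iff (mul_ne_zero hE0' hH0)]
    field_simp
    linear_combination (c * sinh (β * x / 2)) * hE0

/-- The duality relation between the poles and the zeros of a meromorphic function with power-law
behaviour whose odd part is proportional to the spectral density of a thermal correlator with the
same poles. -/
lemma spectralDualityRelation_of_hasPowerLaw {β : ℝ} (hβ : 0 < β) {G : ℂ → ℂ}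
    (hG : IsRetardedCorrelator G) (hT : ThermalProductHypothesis β G) {R : ℕ → ℝ}
    (hR : IsRadialSequence R) {H : ℂ → ℂ} (hH : Meromorphic H) (hp : HasSimplePoles H)
    (hz : HasSimpleZeros H) (hpoles : poles H = poles G) (h0 : AnalyticAt ℂ H 0) (hH0 : H 0 ≠ 0)
    {c : ℂ} (hHG : ∀ x, ∀ᶠ z in 𝓝[≠] x, H z - H (-z) = c * (G z - G (-z)))
    (hpl : HasPowerLaw R H) :
    SpectralDualityRelation β R (poles G) (zeros H) (-c * thermalCoeff β G / H 0) := by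
  have htop := meromorphicOrderAt_ne_top_of_ne_zero hH h0 hH0
  choose A hA using fun N ↦ exists_finset_of_order_ne_zero hH htop (s := poles H)
    (fun w hw ↦ ne_of_lt hw) (R N)
  choose B hB using fun N ↦ exists_finset_of_order_ne_zero hH htop (s := zeros H)
    (fun w hw ↦ ne_of_gt hw) (R N)
  obtain ⟨g, hg1, hg2, hg3⟩ := exists_ratio_remainder hH htop hp hz h0 hH0 hR hpl hA hB
  refine spectralDualityRelation_of_remainder hβ hG hT hR hH hH0 (fun x ↦ ?_) hHG
    (hpoles ▸ hA) hB hg1 hg2 hg3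
  rcases le_or_gt 0 (meromorphicOrderAt H x) with h | h
  · exact Or.inl h
  · exact Or.inr ⟨hpoles ▸ h, hp x h⟩

/-- The duality relation between the poles of a thermal correlator and themselves. -/
lemma spectralDualityRelation_self {β : ℝ} (hβ : 0 < β) {G : ℂ → ℂ}
    (hG : IsRetardedCorrelator G) (hT : ThermalProductHypothesis β G) (hG0 : G 0 ≠ 0) {R : ℕ → ℝ}
    (hR : IsRadialSequence R) : SpectralDualityRelation β R (poles G) (poles G) 0 := by
  have htop := meromorphicOrderAt_ne_top_of_ne_zero hG.meromorphic
    (hG.analyticAt 0 (by simp)) hG0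
  choose A hA using fun N ↦ exists_finset_of_order_ne_zero hG.meromorphic htop (s := poles G)
    (fun w hw ↦ ne_of_lt hw) (R N)
  -- With `H = 1` the spectral function is `E / E(0)`, which is even.
  have := spectralDualityRelation_of_remainder hβ hG hT hR (H := fun _ ↦ 1) (c := 0)
    (g := fun _ _ ↦ 1) (fun x ↦ analyticAt_const.meromorphicAt) one_ne_zero
    (fun x ↦ Or.inl analyticAt_const.meromorphicOrderAt_nonneg) (fun x ↦ by simp) hA hA
    (fun _ _ _ ↦ continuousAt_const) (fun N x ↦ by simp [mul_comm])
    (fun _ ↦ tendsto_const_nhds)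
  simpa using this

/-! ### Deformed correlators and their spectra -/

/-- At a pole the constant 1 is of higher order and does not affect the leading term; elsewhere no
pole can be created. -/
lemma meromorphicOrderAt_one_add_mul {G : ℂ → ℂ} (hG : Meromorphic G) {c : ℂ} (hc : c ≠ 0)
    (x : ℂ) : (meromorphicOrderAt G x < 0 →
        meromorphicOrderAt (fun z ↦ 1 + c * G z) x = meromorphicOrderAt G x) ∧
      (0 ≤ meromorphicOrderAt G x → 0 ≤ meromorphicOrderAt (fun z ↦ 1 + c * G z) x) := by
  have h1 : AnalyticAt ℂ (fun _ : ℂ ↦ (1 : ℂ)) x := analyticAt_const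
  have h1' := meromorphicOrderAt_eq_zero_of_ne_zero h1 one_ne_zero
  have hcG : MeromorphicAt (fun z ↦ c * G z) x := (MeromorphicAt.const c x).fun_mul (hG x)
  have h2 : meromorphicOrderAt (fun z ↦ c * G z) x = meromorphicOrderAt G x :=
    meromorphicOrderAt_mul_of_ne_zero (g := fun _ ↦ c) analyticAt_const hc
  refine ⟨fun h ↦ ?_, fun h ↦ ?_⟩
  · exact (meromorphicOrderAt_add_eq_right_of_lt h1.meromorphicAt (by rwa [h1', h2])).trans h2
  · refine le_trans (le_min ?_ ?_) (meromorphicOrderAt_add h1.meromorphicAt hcG)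
    · exact h1'.ge
    · rwa [h2]

lemma poles_one_add_mul {G : ℂ → ℂ} (hG : Meromorphic G) {c : ℂ} (hc : c ≠ 0) :
    poles (fun z ↦ 1 + c * G z) = poles G := by
  ext x
  obtain ⟨h1, h2⟩ := meromorphicOrderAt_one_add_mul hG hc x
  constructor
  · intro h
    by_contra h'
    exact absurd (h2 (not_lt.1 h')) (not_le.2 h)
  · intro h
    change meromorphicOrderAt _ _ < 0
    rw [h1 h]
    exact h

lemma hasSimplePoles_one_add_mul {G : ℂ → ℂ} (hG : Meromorphic G) (hp : HasSimplePoles G) {c : ℂ}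
    (hc : c ≠ 0) : HasSimplePoles fun z ↦ 1 + c * G z := by
  intro x hx
  rw [poles_one_add_mul hG hc] at hx
  rw [(meromorphicOrderAt_one_add_mul hG hc x).1 hx, hp x hx]

/-- If `K` is the inverse of `H`, the zeros of `H` are the poles of `K`. -/
lemma zeros_eq_poles_of_inv {H K : ℂ → ℂ} (h : ∀ x, ∀ᶠ z in 𝓝[≠] x, K z = (H z)⁻¹)
    (htop : ∀ x, meromorphicOrderAt K x ≠ ⊤) (hp : HasSimplePoles K) :
    zeros H = poles K ∧ HasSimpleZeros H := by
  have hord : ∀ x, meromorphicOrderAt H x = -meromorphicOrderAt K x := fun x ↦ by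
    rw [meromorphicOrderAt_congr (f₁ := K) (f₂ := H⁻¹) (h x), meromorphicOrderAt_inv, neg_neg]
  have hzp : zeros H = poles K := by
    ext x
    change 0 < meromorphicOrderAt H x ↔ meromorphicOrderAt K x < 0
    rw [hord]
    lift meromorphicOrderAt K x to ℤ using htop x with n
    rw [← WithTop.LinearOrderedAddCommGroup.coe_neg]
    norm_cast
    lia
  refine ⟨hzp, fun x hx ↦ ?_⟩
  rw [hord, hp x (hzp ▸ hx)]
  rfl

/-- At a coupling where the deformed correlator is holomorphic at the origin, the deformation is
regular there. -/
lemma one_add_mul_ne_zero {β : ℝ} (hβ : 0 < β) {G₀ : ℂ → ℂ} (hG₀ : IsRetardedCorrelator G₀)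
    (hT : ThermalProductHypothesis β G₀) (hG₀0 : G₀ 0 ≠ 0) {f : ℝ}
    (hf : IsRetardedCorrelator (deformed G₀ f)) : 1 + f * G₀ 0 ≠ 0 := by
  intro h
  have hG₀a : AnalyticAt ℂ G₀ 0 := hG₀.analyticAt 0 (by simp)
  have hfa : AnalyticAt ℂ (deformed G₀ f) 0 := hf.analyticAt 0 (by simp)
  have hD : AnalyticAt ℂ (fun z ↦ 1 + f * G₀ z) 0 := by fun_prop
  -- A denominator vanishing identically near 0 must be excluded separately, since division by zero
  -- makes the deformed correlator locally 0. It would force `f = 0` or `G₀'(0) = 0`, and the latter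
  -- contradicts `E(0) μ = 1`. Otherwise multiplying out the denominator at 0 gives `G₀ 0 = 0`.
  rcases hD.eventually_eq_zero_or_eventually_ne_zero with h1 | h1
  · obtain ⟨E, -, -, -, -, -, hE⟩ := exists_thermal_entire hβ hG₀ hT
    have h2 : deriv (fun z ↦ 1 + f * G₀ z) 0 = 0 := by
      rw [Filter.EventuallyEq.deriv_eq (f₁ := fun z ↦ 1 + f * G₀ z) (f := fun _ ↦ 0) h1]
      simp
    have h3 : HasDerivAt (fun z ↦ 1 + f * G₀ z) (f * deriv G₀ 0) 0 :=
      (hG₀a.differentiableAt.hasDerivAt.const_mul _).const_add _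
    rw [h3.deriv, mul_eq_zero] at h2
    rcases h2 with h2 | h2
    · simp [h2] at h
    · simp [thermalCoeff, h2] at hE
  · have h2 := eq_of_eventuallyEq_nhdsNE (f := fun z ↦ deformed G₀ f z * (1 + f * G₀ z))
      (g := G₀) (x := 0) (hfa.continuousAt.mul hD.continuousAt) hG₀a.continuousAt
      (by
        filter_upwards [h1] with z hz
        rw [deformed, div_mul_cancel₀ _ hz])
    simp only [h, mul_zero] at h2
    exact hG₀0 h2.symm

lemma eventually_one_add_mul_ne_zero {G₀ : ℂ → ℂ} (hG₀ : IsRetardedCorrelator G₀) {f : ℂ}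
    (hf : 1 + f * G₀ 0 ≠ 0) (x : ℂ) : ∀ᶠ z in 𝓝[≠] x, 1 + f * G₀ z ≠ 0 := by
  have hm : Meromorphic fun z ↦ 1 + f * G₀ z := fun x ↦
    (MeromorphicAt.const 1 x).fun_add ((MeromorphicAt.const f x).fun_mul (hG₀.meromorphic x))
  have hG₀a : AnalyticAt ℂ G₀ 0 := hG₀.analyticAt 0 (by simp)
  exact (meromorphicOrderAt_ne_top_iff_eventually_ne_zero (hm x)).1
    (meromorphicOrderAt_ne_top_of_ne_zero hm (x := 0) (by fun_prop) hf x)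

lemma thermalCoeff_deformed {β : ℝ} {G₀ : ℂ → ℂ} (hG₀ : IsRetardedCorrelator G₀) {f : ℝ}
    (hf : 1 + f * G₀ 0 ≠ 0) :
    thermalCoeff β (deformed G₀ f) = thermalCoeff β G₀ / (1 + f * G₀ 0) ^ 2 := by
  have hd : HasDerivAt G₀ (deriv G₀ 0) 0 :=
    (hG₀.analyticAt 0 (by simp)).differentiableAt.hasDerivAt
  have h1 : HasDerivAt (deformed G₀ f) ((deriv G₀ 0 * (1 + f * G₀ 0) -
      G₀ 0 * (f * deriv G₀ 0)) / (1 + f * G₀ 0) ^ 2) 0 :=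
    hd.div ((hd.const_mul _).const_add _) hf
  rw [thermalCoeff, thermalCoeff, h1.deriv]
  ring

/-- The duality relation between the spectra at two different couplings. -/
lemma spectralDualityRelation_deformed {β : ℝ} (hβ : 0 < β) {G₀ : ℂ → ℂ}
    (hG₀ : IsRetardedCorrelator G₀) (hG₀0 : G₀ 0 ≠ 0) {f₁ f₂ : ℝ} (hne : f₁ ≠ f₂)
    (h1 : IsRetardedCorrelator (deformed G₀ f₁)) (hT1 : ThermalProductHypothesis β (deformed G₀ f₁))
    (h2 : IsRetardedCorrelator (deformed G₀ f₂)) (hf₁ : 1 + f₁ * G₀ 0 ≠ 0)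
    (hf₂ : 1 + f₂ * G₀ 0 ≠ 0) {R : ℕ → ℝ} (hR : IsRadialSequence R)
    (hpl : HasPowerLaw R (relativeFactor G₀ f₁ f₂)) :
    SpectralDualityRelation β R (poles (deformed G₀ f₁)) (poles (deformed G₀ f₂))
      (spectralParam β G₀ * ((f₂ - f₁) * G₀ 0) / ((1 + f₁ * G₀ 0) * (1 + f₂ * G₀ 0))) := by
  have hc : (f₂ : ℂ) - f₁ ≠ 0 := sub_ne_zero.2 (by exact_mod_cast hne.symm)
  have hc' : (f₁ : ℂ) - f₂ ≠ 0 := sub_ne_zero.2 (by exact_mod_cast hne)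
  have hHm : Meromorphic (relativeFactor G₀ f₁ f₂) := fun x ↦
    (MeromorphicAt.const 1 x).fun_add ((MeromorphicAt.const _ x).fun_mul (h1.meromorphic x))
  -- The relative factor equals `(1 + f₂ G₀) / (1 + f₁ G₀)`, so exchanging the couplings inverts it.
  have hinv : ∀ x, ∀ᶠ z in 𝓝[≠] x,
      1 + ((f₁ : ℂ) - f₂) * deformed G₀ f₂ z = (relativeFactor G₀ f₁ f₂ z)⁻¹ := by
    intro x
    filter_upwards [eventually_one_add_mul_ne_zero hG₀ hf₁ x,
      eventually_one_add_mul_ne_zero hG₀ hf₂ x] with z e1 e2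
    have e3 : relativeFactor G₀ f₁ f₂ z = (1 + f₂ * G₀ z) / (1 + f₁ * G₀ z) := by
      rw [relativeFactor, deformed]
      field_simp
      ring
    rw [e3, inv_div, deformed]
    field_simp
    ring
  have hK0 : 1 + ((f₁ : ℂ) - f₂) * deformed G₀ f₂ 0 ≠ 0 := by
    have e1 : 1 + ((f₁ : ℂ) - f₂) * deformed G₀ f₂ 0 = (1 + f₁ * G₀ 0) / (1 + f₂ * G₀ 0) := by
      rw [deformed]
      field_simp
      ring
    rw [e1]
    exact div_ne_zero hf₁ hf₂
  have hKm : Meromorphic fun z ↦ 1 + ((f₁ : ℂ) - f₂) * deformed G₀ f₂ z := fun x ↦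
    (MeromorphicAt.const 1 x).fun_add ((MeromorphicAt.const _ x).fun_mul (h2.meromorphic x))
  have hKa : AnalyticAt ℂ (fun z ↦ 1 + ((f₁ : ℂ) - f₂) * deformed G₀ f₂ z) 0 :=
    analyticAt_const.add (analyticAt_const.mul (h2.analyticAt 0 (by simp)))
  obtain ⟨hz1, hz2⟩ := zeros_eq_poles_of_inv hinv (meromorphicOrderAt_ne_top_of_ne_zero hKm hKa hK0)
    (hasSimplePoles_one_add_mul h2.meromorphic h2.simplePoles hc')
  rw [poles_one_add_mul h2.meromorphic hc'] at hz1
  have hH0 : relativeFactor G₀ f₁ f₂ 0 = (1 + f₂ * G₀ 0) / (1 + f₁ * G₀ 0) := by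
    rw [relativeFactor, deformed]
    field_simp
    ring
  have hHa : AnalyticAt ℂ (relativeFactor G₀ f₁ f₂) 0 :=
    analyticAt_const.add (analyticAt_const.mul (h1.analyticAt 0 (by simp)))
  have key := spectralDualityRelation_of_hasPowerLaw hβ h1 hT1 hR hHm
    (hasSimplePoles_one_add_mul h1.meromorphic h1.simplePoles hc) hz2
    (poles_one_add_mul h1.meromorphic hc) hHa (hH0 ▸ div_ne_zero hf₂ hf₁)
    (c := f₂ - f₁) (fun x ↦ Eventually.of_forall fun z ↦ by
      rw [relativeFactor, relativeFactor]
      ring) hpl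
  -- The thermal coefficient contributes `(1 + f₁ G₀(0))⁻²` and `1 / H(0)` contributes `(1 + f₁
  -- G₀(0)) / (1 + f₂ G₀(0))`; together they give the stated denominator.
  rw [hz1, hH0, thermalCoeff_deformed hG₀ hf₁] at key
  convert key using 1
  rw [spectralParam]
  field_simp

end SpectralDuality

end

theorem mainTheorem10 (β : ℝ) (hβ : 0 < β) (G₀ : ℂ → ℂ)
    (hG₀ : SpectralDuality.IsRetardedCorrelator G₀)
    (hG₀T : SpectralDuality.ThermalProductHypothesis β G₀)
    (hG₀0 : G₀ 0 ≠ 0) :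
    (SpectralDuality.HasSimpleZeros G₀ →
      ∀ R₀ : ℕ → ℝ, SpectralDuality.IsRadialSequence R₀ → SpectralDuality.HasPowerLaw R₀ G₀ →
        SpectralDuality.SpectralDualityRelation β R₀
          (SpectralDuality.poles G₀) (SpectralDuality.zeros G₀)
          (SpectralDuality.spectralParam β G₀)) ∧
    ∀ f₁ f₂ : ℝ,
      SpectralDuality.IsRetardedCorrelator (SpectralDuality.deformed G₀ f₁) →
      SpectralDuality.ThermalProductHypothesis β (SpectralDuality.deformed G₀ f₁) →
      SpectralDuality.IsRetardedCorrelator (SpectralDuality.deformed G₀ f₂) →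
      SpectralDuality.ThermalProductHypothesis β (SpectralDuality.deformed G₀ f₂) →
      ∀ R : ℕ → ℝ, SpectralDuality.IsRadialSequence R →
        SpectralDuality.HasPowerLaw R (SpectralDuality.relativeFactor G₀ f₁ f₂) →
        1 + f₁ * G₀ 0 ≠ 0 ∧ 1 + f₂ * G₀ 0 ≠ 0 ∧
        SpectralDuality.SpectralDualityRelation β R
          (SpectralDuality.poles (SpectralDuality.deformed G₀ f₁))
          (SpectralDuality.poles (SpectralDuality.deformed G₀ f₂))
          (SpectralDuality.spectralParam β G₀ * ((f₂ - f₁) * G₀ 0) /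
            ((1 + f₁ * G₀ 0) * (1 + f₂ * G₀ 0))) := by

  refine ⟨fun hz R hR hpl ↦ ?_, fun f₁ f₂ h1 hT1 h2 hT2 R hR hpl ↦ ?_⟩
  · have key := SpectralDuality.spectralDualityRelation_of_hasPowerLaw hβ hG₀ hG₀T hR hG₀.meromorphic
      hG₀.simplePoles hz rfl (hG₀.analyticAt 0 (by simp)) hG₀0 (c := 1)
      (fun x ↦ Eventually.of_forall fun z ↦ (one_mul _).symm) hpl
    rwa [neg_one_mul] at key
  · have hf₁ := SpectralDuality.one_add_mul_ne_zero hβ hG₀ hG₀T hG₀0 h1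
    have hf₂ := SpectralDuality.one_add_mul_ne_zero hβ hG₀ hG₀T hG₀0 h2
    refine ⟨hf₁, hf₂, ?_⟩
    -- For equal couplings the relative factor is constant and its zeros no longer describe the
    -- spectrum; the claimed constant is then 0.
    rcases eq_or_ne f₁ f₂ with rfl | hne
    · have key := SpectralDuality.spectralDualityRelation_self hβ h1 hT1 (div_ne_zero hG₀0 hf₁) hR
      simpa using key
    · exact SpectralDuality.spectralDualityRelation_deformed hβ hG₀ hG₀0 hne h1 hT1 h2 hf₁ hf₂ hR hpl
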